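/- There is an absolute constant $c>0$ such that for every $m\ge 0$ and every partial Boolean function $g\subseteq\{0,1\}^m\times\{0,1\}$, \[ \chi(g)\ \ge\ c\,\sqrt{R_{1/3}(g)}\qquad\text{and}\qquad \bar\chi(g)\ \ge\ c\,\sqrt{R_{1/3}(g)} . \] Here $g^{-1}(b)$ is the set of $x\in\{0,1\}^m$ with $(x,b)\in g$ and $(x,1-b)\notin g$; a partial Boolean function is a relation $g$ such that $(x,0),(x,1)\in g$ for every $x\notin g^{-1}(0)\cup g^{-1}(1)$. A deterministic decision tree $T$ computes $g$ if $(x,T(x))\in g$ for all $x\in\{0,1\}^m$. $R_{1/3}(g)$ is the least $\ell$ for which some probability distribution over deterministic decision trees, each making at most $\ell$ queries on every input, satisfies $\Pr_T[(x,T(x))\in g]\ge 2/3$ for all $x\in\{0,1\}^m$. Let $\mu_0,\mu_1$ be probability distributions supported on $g^{-1}(0),g^{-1}(1)$, and let $T$ be a decision tree computing $g$. For an internal vertex $v$ of $T$ let $q(v)$ be the index queried at $v$, $d_T(v)$ the number of vertices on the path from the root to $v$ (the root has depth $1$), $p_b(v)=\Pr_{x\sim\mu_b}[x_{q(v)}=0\mid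 x\text{ reaches }v]$, and $\Delta(v)=|p_0(v)-p_1(v)|$. Let $R(v)=1$ if $v$ is the root and $R(v)=R(u)\cdot\min_{b\in\{0,1\}}\Pr_{x\sim\mu_b}[x\text{ reaches }v\mid x\text{ reaches }u]$ if $v$ has parent $u$. (Conditional probabilities given an event of probability zero are taken to be $0$; they only occur where $R$ vanishes.) Put $\chi(T,(\mu_0,\mu_1))=\sum_{v}d_T(v)\,\Delta(v)\,R(v)$, the sum being over the internal vertices of $T$. The conflict complexity is $\chi(g)=\max_{(\mu_0,\mu_1)}\min_T\chi(T,(\mu_0,\mu_1))$, and the max conflict complexity is $\bar\chi(g)=\max_{\mathcal Q}\min_T\mathbb E_{(\mu_0,\mu_1)\sim\mathcal Q}[\chi(T,(\mu_0,\mu_1))]$. Here $(\mu_0,\mu_1)$ ranges over all pairs of distributions supported on $g^{-1}(0)$ and $g^{-1}(1)$ respectively, $\mathcal Q$ over all probability distributions on such pairs, and $T$ over all deterministic decision trees computing $g$ (maxima and minima are read as suprema and infima). Both quantities are $0$ if $g^{-1}(0)$ or $g^{-1}(1)$ is empty. -/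

import Mathlib

open MeasureTheory
open scoped ENNReal

noncomputable section

/-- Deterministic query algorithms on `m`-bit inputs with outputs in `S`, as binary decision trees:
`query i T₀ T₁` queries the bit `x i`, and continues with `T₀` if it is `0` (`false`) and with
`T₁` if it is `1` (`true`). -/
inductive DecisionTree (m : ℕ) (S : Type) : Type where
  | leaf (s : S) : DecisionTree m S
  | query (i : Fin m) (T₀ T₁ : DecisionTree m S) : DecisionTree m S

namespace DecisionTree

variable {m : ℕ} {S : Type}

/-- The output of the tree on input `x`. -/
def output : DecisionTree m S → (Fin m → Bool) → S
  | leaf s, _ => s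
  | query i T₀ T₁, x => if x i then T₁.output x else T₀.output x

/-- The number of queries that the tree makes on input `x`. -/
def numQueries : DecisionTree m S → (Fin m → Bool) → ℕ
  | leaf _, _ => 0
  | query i T₀ T₁, x => 1 + (if x i then T₁.numQueries x else T₀.numQueries x)

/-- The tree computes the relation `h`. -/
def Computes (T : DecisionTree m S) (h : Set ((Fin m → Bool) × S)) : Prop :=
  ∀ x, (x, T.output x) ∈ h

end DecisionTree

/-- A randomized query algorithm, i.e. a probability distribution `A` over deterministic query
algorithms, computes the relation `h` with error `ε`. -/
def RandComputes {m : ℕ} {S : Type} (A : PMF (DecisionTree m S)) (h : Set ((Fin m → Bool) × S))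
    (ε : ℝ) : Prop :=
  ∀ x, ENNReal.ofReal (1 - ε) ≤ A.toOuterMeasure {T | (x, T.output x) ∈ h}

/-- The bounded-error randomized query complexity `R_ε(h)`: the least worst-case number of queries,
over all inputs and all internal randomness, of a randomized query algorithm that computes `h`
with error `ε`. -/
def randQueryComplexity {m : ℕ} {S : Type} (ε : ℝ) (h : Set ((Fin m → Bool) × S)) : ℕ :=
  sInf {l : ℕ | ∃ A : PMF (DecisionTree m S),
    RandComputes A h ε ∧ ∀ T ∈ A.support, ∀ x, T.numQueries x ≤ l}

/-- `g⁻¹(b)`: the strings for which `b` is the only correct output. -/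
def validPreimage {m : ℕ} (g : Set ((Fin m → Bool) × Bool)) (b : Bool) : Set (Fin m → Bool) :=
  {x | (x, b) ∈ g ∧ (x, !b) ∉ g}

/-- A partial Boolean function is a relation in which both outputs are correct for every string
that is not a valid input. -/
def IsPartialBoolFun {m : ℕ} (g : Set ((Fin m → Bool) × Bool)) : Prop :=
  ∀ x, x ∉ validPreimage g false ∪ validPreimage g true → (x, false) ∈ g ∧ (x, true) ∈ g

/-- Probability distributions on `{0,1}^m`, given by their weights. They form a subspace of
`ℝ^(2^m)`, and carry its (Borel) measurable structure. -/
abbrev Distr (m : ℕ) : Type := stdSimplex ℝ (Fin m → Bool)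

/-- The support of `μ` is contained in `A`. -/
def Distr.SupportedOn {m : ℕ} (μ : Distr m) (A : Set (Fin m → Bool)) : Prop :=
  ∀ x, μ.1 x ≠ 0 → x ∈ A

/-- `Pr_{x ∼ μ}[x ∈ C]`. -/
def Distr.prob {m : ℕ} (μ : Distr m) (C : Set (Fin m → Bool)) : ℝ :=
  ∑ x, C.indicator μ.1 x

/-- `Pr_{x ∼ μ}[x_i = b ∣ x ∈ C]` (it is `0` if `Pr_{x ∼ μ}[x ∈ C] = 0`). -/
def Distr.condBit {m : ℕ} (μ : Distr m) (C : Set (Fin m → Bool)) (i : Fin m) (b : Bool) : ℝ :=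
  μ.prob (C ∩ {x | x i = b}) / μ.prob C

/-- The sum of `d(v) Δ(v) R(v)` over all (non-leaf) vertices `v` of a subtree. The first argument
is the subtree; `C`, `d`, `r` are the subcube of the inputs that reach its root `v`, the depth
`d(v)` and the value `R(v)`. The two children have depth `d(v) + 1`, and the child for the answer
`b` has `R`-value `R(v) · min {Pr_{μ₀}[x_{q(v)} = b ∣ x at v], Pr_{μ₁}[x_{q(v)} = b ∣ x at v]}`.
(If `v` has probability `0` under `μ₀` or `μ₁`, then `R(v) = 0`.) -/
def conflictSum {m : ℕ} (μ₀ μ₁ : Distr m) :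
    DecisionTree m Bool → Set (Fin m → Bool) → ℕ → ℝ → ℝ
  | .leaf _, _, _, _ => 0
  | .query i T₀ T₁, C, d, r =>
      d * |μ₀.condBit C i false - μ₁.condBit C i false| * r
      + conflictSum μ₀ μ₁ T₀ (C ∩ {x | x i = false}) (d + 1)
          (r * min (μ₀.condBit C i false) (μ₁.condBit C i false))
      + conflictSum μ₀ μ₁ T₁ (C ∩ {x | x i = true}) (d + 1)
          (r * min (μ₀.condBit C i true) (μ₁.condBit C i true))

/-- `χ(T, (μ₀, μ₁)) = ∑_{v ∈ T} d_T(v) Δ(v) R(v)`. The root has depth `1` and `R`-value `1`. -/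
def treeConflict {m : ℕ} (T : DecisionTree m Bool) (μ₀ μ₁ : Distr m) : ℝ :=
  conflictSum μ₀ μ₁ T Set.univ 1 1

/-- The conflict complexity `χ(g) = max_{μ₀, μ₁} min_T χ(T, (μ₀, μ₁))`, over the distributions `μ₀`
on `g⁻¹(0)` and `μ₁` on `g⁻¹(1)` and the trees `T` that compute `g`. It is `0` if one of
`g⁻¹(0)`, `g⁻¹(1)` is empty. -/
def conflictComplexity {m : ℕ} (g : Set ((Fin m → Bool) × Bool)) : ℝ≥0∞ :=
  ⨆ (μ₀ : Distr m) (μ₁ : Distr m)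
    (_ : μ₀.SupportedOn (validPreimage g false)) (_ : μ₁.SupportedOn (validPreimage g true)),
  ⨅ (T : DecisionTree m Bool) (_ : T.Computes g), ENNReal.ofReal (treeConflict T μ₀ μ₁)

/-- `Q`, a distribution over pairs of distributions, is consistent with `g`: almost every pair
consists of a distribution on `g⁻¹(0)` and one on `g⁻¹(1)`. -/
def ConsistentWith {m : ℕ} (Q : ProbabilityMeasure (Distr m × Distr m))
    (g : Set ((Fin m → Bool) × Bool)) : Prop :=
  ∀ᵐ p ∂(Q : Measure (Distr m × Distr m)),
    p.1.SupportedOn (validPreimage g false) ∧ p.2.SupportedOn (validPreimage g true)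

/-- The max conflict complexity
`max_Q min_T E_{(μ₀, μ₁) ∼ Q} [χ(T, (μ₀, μ₁))]`, over the distributions `Q` over pairs that are
consistent with `g` and the trees `T` that compute `g`. -/
def maxConflictComplexity {m : ℕ} (g : Set ((Fin m → Bool) × Bool)) : ℝ≥0∞ :=
  ⨆ (Q : ProbabilityMeasure (Distr m × Distr m)) (_ : ConsistentWith Q g),
  ⨅ (T : DecisionTree m Bool) (_ : T.Computes g),
    ∫⁻ p, ENNReal.ofReal (treeConflict T p.1 p.2) ∂(Q : Measure (Distr m × Distr m))

end

/-! By Yao's principle it suffices to bound the error on a fixed input distribution, split into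
weights `a` on `g⁻¹(0)` and `b` on `g⁻¹(1)`. The progress measure is the affinity `√(μ₀(C) μ₁(C))`
summed over the subcubes `C` reached. It bounds the error of the best constant outputs, and a query
with bias gap `Δ` multiplies the affinity of its subcube by at most `1 - Δ²/2`.

Let `T` compute `g` and have small conflict. Since a minimum is at most a geometric mean, `R(v)`
never exceeds the affinity at `v`. A vertex passes `R(v)(1 - Δ(v))` to its children, and `R`
vanishes at the leaves, so the lost amounts `R(v)Δ(v)` form a probability distribution over the
vertices whose mean depth is the conflict. If that mean is at most `(k+1)/2`, Markov's inequality
says that at least half of the mass is lost during the first `k` queries. Since `Δ² ≥ 2tΔ - t²` and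
`R` sums to at most `1` on each level, the affinity then drops by a factor `1 - 1/(8k)`
(`exists_errorOn_le`).

Renormalizing at every subcube reached and repeating for `16k` rounds (`exists_errorOn_le_pow`)
brings the error below `e⁻² ≤ 1/3` with `16k²` queries. The bound for the max conflict complexity
follows by taking `Q` to be a point mass. -/

namespace Distr

variable {m : ℕ}

/-! ### Probabilities of subcubes and conditional bits -/

lemma prob_nonneg (μ : Distr m) (C : Set (Fin m → Bool)) : 0 ≤ μ.prob C :=
  Finset.sum_nonneg fun x _ => Set.indicator_nonneg (fun y _ => μ.2.1 y) x

lemma prob_univ (μ : Distr m) : μ.prob Set.univ = 1 := by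
  simpa [prob] using μ.2.2

lemma prob_eq_zero {μ : Distr m} {A C : Set (Fin m → Bool)} (h : μ.SupportedOn A)
    (hAC : ∀ x ∈ C, x ∉ A) : μ.prob C = 0 := by
  refine Finset.sum_eq_zero fun x _ => ?_
  by_cases hx : x ∈ C
  · rw [Set.indicator_of_mem hx]
    by_contra hne
    exact hAC x hx (h x hne)
  · exact Set.indicator_of_notMem hx _

end Distr

/-- Summing over a set of inputs is summing over its two halves given by a bit. -/
lemma sum_indicator_eq_add {m : ℕ} (f : (Fin m → Bool) → ℝ) (C : Set (Fin m → Bool)) (i : Fin m) :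
    ∑ x, C.indicator f x = ∑ x, (C ∩ {x | x i = false}).indicator f x
      + ∑ x, (C ∩ {x | x i = true}).indicator f x := by
  rw [← Finset.sum_add_distrib]
  refine Finset.sum_congr rfl fun x _ => ?_
  by_cases hx : x ∈ C <;> cases hi : x i <;> simp [Set.indicator, hx, hi]

namespace Distr

variable {m : ℕ}

lemma prob_eq_add (μ : Distr m) (C : Set (Fin m → Bool)) (i : Fin m) :
    μ.prob C = μ.prob (C ∩ {x | x i = false}) + μ.prob (C ∩ {x | x i = true}) :=
  sum_indicator_eq_add _ C i

lemma condBit_nonneg (μ : Distr m) (C : Set (Fin m → Bool)) (i : Fin m) (b : Bool) :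
    0 ≤ μ.condBit C i b :=
  div_nonneg (μ.prob_nonneg _) (μ.prob_nonneg _)

lemma prob_inter_le (μ : Distr m) (C : Set (Fin m → Bool)) (i : Fin m) (b : Bool) :
    μ.prob (C ∩ {x | x i = b}) ≤ μ.prob C := by
  have h := μ.prob_eq_add C i
  have h₀ := μ.prob_nonneg (C ∩ {x | x i = false})
  have h₁ := μ.prob_nonneg (C ∩ {x | x i = true})
  cases b <;> linarith

lemma condBit_mul_prob (μ : Distr m) (C : Set (Fin m → Bool)) (i : Fin m) (b : Bool) :
    μ.condBit C i b * μ.prob C = μ.prob (C ∩ {x | x i = b}) := by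
  rcases eq_or_ne (μ.prob C) 0 with h | h
  · have h₁ := μ.prob_inter_le C i b
    have h₂ := μ.prob_nonneg (C ∩ {x | x i = b})
    rw [h] at h₁ ⊢
    linarith
  · exact div_mul_cancel₀ _ h

lemma condBit_true (μ : Distr m) {C : Set (Fin m → Bool)} (h : μ.prob C ≠ 0) (i : Fin m) :
    μ.condBit C i true = 1 - μ.condBit C i false := by
  have := μ.prob_eq_add C i
  rw [condBit, condBit, eq_sub_iff_add_eq, ← add_div, add_comm, ← this, div_self h]

end Distr

/-- The Bhattacharyya coefficient of two Bernoulli distributions. -/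
lemma sqrt_mul_add_sqrt_mul_le {p q : ℝ} (hp : 0 ≤ p) (hp' : p ≤ 1) (hq : 0 ≤ q) (hq' : q ≤ 1) :
    √(p * q) + √((1 - p) * (1 - q)) ≤ 1 - |p - q| ^ 2 / 2 := by
  rw [sq_abs, Real.sqrt_mul hp, Real.sqrt_mul (sub_nonneg.2 hp')]
  obtain ⟨a, ha⟩ : ∃ a, a = √p := ⟨_, rfl⟩
  obtain ⟨b, hb⟩ : ∃ b, b = √q := ⟨_, rfl⟩
  obtain ⟨c, hc⟩ : ∃ c, c = √(1 - p) := ⟨_, rfl⟩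
  obtain ⟨e, he⟩ : ∃ e, e = √(1 - q) := ⟨_, rfl⟩
  rw [← ha, ← hb, ← hc, ← he]
  have ha2 : a ^ 2 = p := by rw [ha, Real.sq_sqrt hp]
  have hb2 : b ^ 2 = q := by rw [hb, Real.sq_sqrt hq]
  have hc2 : c ^ 2 = 1 - p := by rw [hc, Real.sq_sqrt (by linarith)]
  have he2 : e ^ 2 = 1 - q := by rw [he, Real.sq_sqrt (by linarith)]
  have ha0 : 0 ≤ a := ha ▸ Real.sqrt_nonneg _
  have hb0 : 0 ≤ b := hb ▸ Real.sqrt_nonneg _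
  have hc0 : 0 ≤ c := hc ▸ Real.sqrt_nonneg _
  have he0 : 0 ≤ e := he ▸ Real.sqrt_nonneg _
  have hac : a ^ 2 + c ^ 2 = 1 := by linarith
  have hbe : b ^ 2 + e ^ 2 = 1 := by linarith
  -- For the unit vectors `(a, c)` and `(b, e)` this is `cos² = 1 - sin²`; the sine bounds `|p - q|`
  -- from above.
  have hbc : (a * b + c * e) ^ 2 = 1 - (a * e - c * b) ^ 2 := by
    linear_combination (b ^ 2 + e ^ 2) * hac + hbe
  have hsum : a * e + c * b ≤ 1 := by nlinarith [sq_nonneg (a - e), sq_nonneg (c - b)]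
  have hsum0 : 0 ≤ a * e + c * b := by positivity
  have hdiff : p - q = (a * e - c * b) * (a * e + c * b) := by
    linear_combination hb2 + b ^ 2 * hac - (e ^ 2 + b ^ 2) * ha2 - p * hbe
  have hsq : (p - q) ^ 2 ≤ (a * e - c * b) ^ 2 := by
    rw [hdiff, mul_pow]
    exact mul_le_of_le_one_right (sq_nonneg _) (pow_le_one₀ hsum0 hsum)
  have hpq : (p - q) ^ 2 ≤ 1 := by
    rw [sq_le_one_iff_abs_le_one, abs_le]
    constructor <;> linarith
  -- After squaring, `1 - Δ² ≤ (1 - Δ²/2)²` suffices, where `Δ = |p - q|`.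
  refine abs_le_of_sq_le_sq' ?_ (by linarith) |>.2
  nlinarith [sq_nonneg ((p - q) ^ 2)]

/-! ### Affinity against conflict along one tree -/

section Conflict

variable {m : ℕ} (μ₀ μ₁ : Distr m)

/-- The geometric mean of the weights of `C` under `μ₀` and `μ₁`. -/
noncomputable def affinity (C : Set (Fin m → Bool)) : ℝ := √(μ₀.prob C * μ₁.prob C)

variable {μ₀ μ₁}

lemma affinity_nonneg (C : Set (Fin m → Bool)) : 0 ≤ affinity μ₀ μ₁ C := Real.sqrt_nonneg _

lemma prob_ne_zero_of_affinity_pos {C : Set (Fin m → Bool)} (h : 0 < affinity μ₀ μ₁ C) :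
    μ₀.prob C ≠ 0 ∧ μ₁.prob C ≠ 0 :=
  mul_ne_zero_iff.1 (Real.sqrt_pos.1 h).ne'

lemma affinity_inter (C : Set (Fin m → Bool)) (i : Fin m) (b : Bool) :
    affinity μ₀ μ₁ (C ∩ {x | x i = b}) =
      affinity μ₀ μ₁ C * √(μ₀.condBit C i b * μ₁.condBit C i b) := by
  rw [affinity, affinity, ← μ₀.condBit_mul_prob, ← μ₁.condBit_mul_prob,
    ← Real.sqrt_mul (mul_nonneg (μ₀.prob_nonneg _) (μ₁.prob_nonneg _))]
  congr 1
  ring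

/-- The minimum of two numbers is at most their geometric mean, so the invariant `r ≤ affinity`
passes to the children. -/
lemma mul_min_le_affinity_inter {C : Set (Fin m → Bool)} {r : ℝ} (hr : r ≤ affinity μ₀ μ₁ C)
    (i : Fin m) (b : Bool) :
    r * min (μ₀.condBit C i b) (μ₁.condBit C i b) ≤ affinity μ₀ μ₁ (C ∩ {x | x i = b}) := by
  have h₀ := μ₀.condBit_nonneg C i b
  have h₁ := μ₁.condBit_nonneg C i b
  rw [affinity_inter]
  refine mul_le_mul hr (Real.le_sqrt_of_sq_le ?_) (le_min h₀ h₁) (affinity_nonneg C)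
  rw [sq]
  exact mul_le_mul (min_le_left _ _) (min_le_right _ _) (le_min h₀ h₁) h₀

lemma mul_min_add_mul_min {C : Set (Fin m → Bool)} {r : ℝ} (hr₀ : 0 ≤ r)
    (hr : r ≤ affinity μ₀ μ₁ C) (i : Fin m) :
    r * min (μ₀.condBit C i false) (μ₁.condBit C i false)
      + r * min (μ₀.condBit C i true) (μ₁.condBit C i true)
      = r * (1 - |μ₀.condBit C i false - μ₁.condBit C i false|) := by
  rcases hr₀.eq_or_lt with rfl | hpos
  · simp
  -- Positive `r` forces positive affinity, which rules out the default value of `condBit`.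
  obtain ⟨h₀, h₁⟩ := prob_ne_zero_of_affinity_pos (hpos.trans_le hr)
  rw [← mul_add, μ₀.condBit_true h₀, μ₁.condBit_true h₁]
  rcases le_total (μ₀.condBit C i false) (μ₁.condBit C i false) with h | h
  · rw [min_eq_left h, min_eq_right (by linarith), abs_of_nonpos (by linarith)]
    ring
  · rw [min_eq_right h, min_eq_left (by linarith), abs_of_nonneg (by linarith)]
    ring

lemma affinity_add_affinity_le {C : Set (Fin m → Bool)} {r : ℝ} (hr : r ≤ affinity μ₀ μ₁ C)
    (i : Fin m) :
    affinity μ₀ μ₁ (C ∩ {x | x i = false}) + affinity μ₀ μ₁ (C ∩ {x | x i = true})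
      ≤ affinity μ₀ μ₁ C - r * |μ₀.condBit C i false - μ₁.condBit C i false| ^ 2 / 2 := by
  rcases (affinity_nonneg (μ₀ := μ₀) (μ₁ := μ₁) C).eq_or_lt with h | hpos
  · rw [affinity_inter, affinity_inter, ← h]
    rw [← h] at hr
    nlinarith [sq_nonneg |μ₀.condBit C i false - μ₁.condBit C i false|]
  obtain ⟨h₀, h₁⟩ := prob_ne_zero_of_affinity_pos hpos
  have e₀ := μ₀.condBit_true h₀ i
  have e₁ := μ₁.condBit_true h₁ i
  have key := sqrt_mul_add_sqrt_mul_le (μ₀.condBit_nonneg C i false)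
    (by linarith [μ₀.condBit_nonneg C i true]) (μ₁.condBit_nonneg C i false)
    (by linarith [μ₁.condBit_nonneg C i true])
  rw [affinity_inter, affinity_inter, e₀, e₁, ← mul_add]
  have h := mul_le_mul_of_nonneg_left key hpos.le
  nlinarith [mul_le_mul_of_nonneg_right hr
    (sq_nonneg |μ₀.condBit C i false - μ₁.condBit C i false|)]

/-- Inputs sharing a correct output `s` include no valid input of the other kind. Hence `R` vanishes
at the leaves of a tree computing `g`. -/
lemma affinity_eq_zero {g : Set ((Fin m → Bool) × Bool)}
    (h₀ : μ₀.SupportedOn (validPreimage g false)) (h₁ : μ₁.SupportedOn (validPreimage g true))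
    {C : Set (Fin m → Bool)} {s : Bool} (hC : ∀ x ∈ C, (x, s) ∈ g) : affinity μ₀ μ₁ C = 0 := by
  cases s with
  | false => rw [affinity, Distr.prob_eq_zero h₁ fun x hx hv => hv.2 (hC x hx)]; simp
  | true => rw [affinity, Distr.prob_eq_zero h₀ fun x hx hv => hv.2 (hC x hx)]; simp

lemma output_mem_inter {g : Set ((Fin m → Bool) × Bool)} {C : Set (Fin m → Bool)} {i : Fin m}
    {T₀ T₁ : DecisionTree m Bool} (h : ∀ x ∈ C, (x, (DecisionTree.query i T₀ T₁).output x) ∈ g) :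
    (∀ x ∈ C ∩ {x | x i = false}, (x, T₀.output x) ∈ g) ∧
      ∀ x ∈ C ∩ {x | x i = true}, (x, T₁.output x) ∈ g := by
  constructor
  · rintro x ⟨hx, hi⟩
    have := h x hx
    rwa [DecisionTree.output, if_neg (by simpa using hi)] at this
  · rintro x ⟨hx, hi⟩
    have := h x hx
    rwa [DecisionTree.output, if_pos (by simpa using hi)] at this

/-- All of the mass `r` is lost before the leaves, and at depth at least `d`. -/
lemma mul_le_conflictSum {g : Set ((Fin m → Bool) × Bool)}
    (h₀ : μ₀.SupportedOn (validPreimage g false)) (h₁ : μ₁.SupportedOn (validPreimage g true))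
    (T : DecisionTree m Bool) : ∀ (C : Set (Fin m → Bool)) (d : ℕ) (r : ℝ), 0 ≤ r →
      r ≤ affinity μ₀ μ₁ C → (∀ x ∈ C, (x, T.output x) ∈ g) →
      d * r ≤ conflictSum μ₀ μ₁ T C d r := by
  induction T with
  | leaf s =>
    intro C d r hr₀ hr hC
    rw [affinity_eq_zero h₀ h₁ hC] at hr
    simp [conflictSum, le_antisymm hr hr₀]
  | query i T₀ T₁ ih₀ ih₁ =>
    intro C d r hr₀ hr hC
    obtain ⟨hC₀, hC₁⟩ := output_mem_inter hC
    have nn : ∀ b, 0 ≤ r * min (μ₀.condBit C i b) (μ₁.condBit C i b) := fun b =>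
      mul_nonneg hr₀ (le_min (μ₀.condBit_nonneg _ _ _) (μ₁.condBit_nonneg _ _ _))
    have i₀ := ih₀ _ (d + 1) _ (nn false) (mul_min_le_affinity_inter hr i false) hC₀
    have i₁ := ih₁ _ (d + 1) _ (nn true) (mul_min_le_affinity_inter hr i true) hC₁
    have hsum := mul_min_add_mul_min hr₀ hr i
    have n₀ := nn false
    have n₁ := nn true
    rw [conflictSum]
    push_cast at i₀ i₁
    linear_combination i₀ + i₁ + n₀ + n₁ - (d : ℝ) * hsum

/-- The weight of the inputs in `C` on which `T` errs, where `a` weights the inputs with correct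
output `false`, and `b` those with correct output `true`. -/
noncomputable def errorOn (a b : (Fin m → Bool) → ℝ) (C : Set (Fin m → Bool)) (T : DecisionTree m Bool) : ℝ :=
  ∑ x, C.indicator (fun x => if T.output x then a x else b x) x

lemma errorOn_query (a b : (Fin m → Bool) → ℝ) (C : Set (Fin m → Bool)) (i : Fin m)
    (T₀ T₁ : DecisionTree m Bool) :
    errorOn a b C (.query i T₀ T₁) =
      errorOn a b (C ∩ {x | x i = false}) T₀ + errorOn a b (C ∩ {x | x i = true}) T₁ := by
  rw [errorOn, sum_indicator_eq_add _ C i]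
  congr 1 <;>
  · refine Finset.sum_congr rfl fun x _ => ?_
    cases hi : x i <;> simp [Set.indicator, hi, DecisionTree.output]

/-- Follow `T` for `j` queries, and continue with trees whose error is controlled by the affinity:
the affinity lost on the way is controlled by the conflict sum. -/
lemma exists_errorOn_le {g : Set ((Fin m → Bool) × Bool)}
    (h₀ : μ₀.SupportedOn (validPreimage g false)) (h₁ : μ₁.SupportedOn (validPreimage g true))
    {a b : (Fin m → Bool) → ℝ} {κ t : ℝ} (hκ : 0 ≤ κ) (ht : 0 ≤ t) {L : ℕ}
    (hF : ∀ C, ∃ F : DecisionTree m Bool,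
      (∀ x, F.numQueries x ≤ L) ∧ errorOn a b C F ≤ κ * affinity μ₀ μ₁ C)
    (T : DecisionTree m Bool) : ∀ (C : Set (Fin m → Bool)) (d j : ℕ) (r : ℝ), 0 < d → 0 ≤ r →
      r ≤ affinity μ₀ μ₁ C → (∀ x ∈ C, (x, T.output x) ∈ g) →
      ∃ T' : DecisionTree m Bool, (∀ x, T'.numQueries x ≤ j + L) ∧ errorOn a b C T' ≤
        κ * (affinity μ₀ μ₁ C
          - (t * (r - conflictSum μ₀ μ₁ T C d r / (d + j)) - t ^ 2 * j * r / 2)) := by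
  induction T with
  | leaf s =>
    intro C d j r hd hr₀ hr hC
    obtain ⟨F, hFq, hFe⟩ := hF C
    rw [affinity_eq_zero h₀ h₁ hC] at hr
    refine ⟨F, fun x => (hFq x).trans (Nat.le_add_left _ _), hFe.trans_eq ?_⟩
    simp [conflictSum, le_antisymm hr hr₀]
  | query i T₀ T₁ ih₀ ih₁ =>
    intro C d j r hd hr₀ hr hC
    have hd' : (0 : ℝ) < d := by exact_mod_cast hd
    cases j with
    | zero =>
      obtain ⟨F, hFq, hFe⟩ := hF C
      refine ⟨F, fun x => (hFq x).trans (Nat.le_add_left _ _), hFe.trans ?_⟩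
      -- With no queries left the promised gain is nonpositive, as all mass is lost at depth at
      -- least `d`.
      have hcs := mul_le_conflictSum h₀ h₁ _ C d r hr₀ hr hC
      have hle : r ≤ conflictSum μ₀ μ₁ (.query i T₀ T₁) C d r / d := by
        rw [le_div_iff₀ hd']
        linarith
      refine mul_le_mul_of_nonneg_left ?_ hκ
      have := mul_nonneg ht (sub_nonneg.2 hle)
      simp only [Nat.cast_zero, add_zero, mul_zero, zero_mul, zero_div]
      linarith
    | succ j =>
      obtain ⟨hC₀, hC₁⟩ := output_mem_inter hC
      have nn : ∀ b, 0 ≤ r * min (μ₀.condBit C i b) (μ₁.condBit C i b) := fun b =>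
        mul_nonneg hr₀ (le_min (μ₀.condBit_nonneg _ _ _) (μ₁.condBit_nonneg _ _ _))
      obtain ⟨U₀, hq₀, he₀⟩ :=
        ih₀ _ (d + 1) j _ d.succ_pos (nn false) (mul_min_le_affinity_inter hr i false) hC₀
      obtain ⟨U₁, hq₁, he₁⟩ :=
        ih₁ _ (d + 1) j _ d.succ_pos (nn true) (mul_min_le_affinity_inter hr i true) hC₁
      refine ⟨.query i U₀ U₁, fun x => ?_, ?_⟩
      · have e₀ := hq₀ x
        have e₁ := hq₁ x
        rw [DecisionTree.numQueries]
        split_ifs <;> omega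
      rw [errorOn_query]
      refine (add_le_add he₀ he₁).trans ?_
      rw [← mul_add]
      refine mul_le_mul_of_nonneg_left ?_ hκ
      have hsum := mul_min_add_mul_min hr₀ hr i
      have haff := affinity_add_affinity_le hr i
      rw [conflictSum]
      have hΔ : 0 ≤ |μ₀.condBit C i false - μ₁.condBit C i false| := abs_nonneg _
      generalize |μ₀.condBit C i false - μ₁.condBit C i false| = Δ at *
      generalize r * min (μ₀.condBit C i false) (μ₁.condBit C i false) = r₀ at *
      generalize r * min (μ₀.condBit C i true) (μ₁.condBit C i true) = r₁ at *
      generalize conflictSum μ₀ μ₁ T₀ _ _ _ = c₀ at *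
      generalize conflictSum μ₀ μ₁ T₁ _ _ _ = c₁ at *
      generalize affinity μ₀ μ₁ (C ∩ {x | x i = false}) = s₀ at *
      generalize affinity μ₀ μ₁ (C ∩ {x | x i = true}) = s₁ at *
      generalize affinity μ₀ μ₁ C = s at *
      have hN : ((d + 1 : ℕ) : ℝ) + j = d + (j + 1 : ℕ) := by push_cast; ring
      rw [hN]
      have hN0 : (0 : ℝ) < d + (j + 1 : ℕ) := by positivity
      generalize (d : ℝ) + (j + 1 : ℕ) = N at *
      rw [add_div, add_div]
      -- `q₁` discards the root's share of the conflict sum, `q₂` bounds the children's total `r(1 -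
      -- Δ)` by `r`, and `q₃` is `Δ² ≥ 2tΔ - t²`.
      have q₁ : 0 ≤ t * (d * Δ * r / N) := by positivity
      have q₂ : 0 ≤ t ^ 2 * j * r * Δ := by positivity
      have q₃ : 0 ≤ r * (Δ - t) ^ 2 := by positivity
      push_cast
      linear_combination haff + q₁ + q₂ / 2 + q₃ / 2 - (t - t ^ 2 * j / 2) * hsum

end Conflict

/-! ### Iterating over rounds, and Yao's principle -/

section Rounds

variable {m : ℕ} {g : Set ((Fin m → Bool) × Bool)}

/-- The better constant errs with weight `min A B ≤ √(A B)`. -/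
lemma exists_errorOn_leaf_le {a b : (Fin m → Bool) → ℝ} (ha : ∀ x, 0 ≤ a x) (hb : ∀ x, 0 ≤ b x) :
    ∃ s, errorOn a b Set.univ (.leaf s) ≤ √((∑ x, a x) * ∑ x, b x) := by
  have hA : 0 ≤ ∑ x, a x := Finset.sum_nonneg fun x _ => ha x
  have hB : 0 ≤ ∑ x, b x := Finset.sum_nonneg fun x _ => hb x
  rcases le_total (∑ x, a x) (∑ x, b x) with h | h
  · refine ⟨true, Real.le_sqrt_of_sq_le ?_⟩
    simp only [errorOn, DecisionTree.output, Set.indicator_univ, if_true]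
    nlinarith
  · refine ⟨false, Real.le_sqrt_of_sq_le ?_⟩
    simp only [errorOn, DecisionTree.output, Set.indicator_univ, Bool.false_eq_true, if_false]
    nlinarith

lemma errorOn_indicator (a b : (Fin m → Bool) → ℝ) (C : Set (Fin m → Bool))
    (T : DecisionTree m Bool) :
    errorOn (C.indicator a) (C.indicator b) Set.univ T = errorOn a b C T := by
  refine Finset.sum_congr rfl fun x _ => ?_
  by_cases hx : x ∈ C <;> simp [Set.indicator, hx]

/-- The distribution with density proportional to `a`. -/
noncomputable def Distr.normalize (a : (Fin m → Bool) → ℝ) (ha : ∀ x, 0 ≤ a x)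
    (hA : ∑ x, a x ≠ 0) : Distr m :=
  ⟨fun x => a x / ∑ y, a y, fun x => div_nonneg (ha x) (Finset.sum_nonneg fun y _ => ha y), by
    rw [← Finset.sum_div, div_self hA]⟩

lemma Distr.sum_mul_prob_normalize {a : (Fin m → Bool) → ℝ} (ha : ∀ x, 0 ≤ a x)
    (hA : ∑ x, a x ≠ 0) (C : Set (Fin m → Bool)) :
    (∑ x, a x) * (normalize a ha hA).prob C = ∑ x, C.indicator a x := by
  rw [prob, Finset.mul_sum]
  refine Finset.sum_congr rfl fun x _ => ?_
  by_cases hx : x ∈ C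
  · rw [Set.indicator_of_mem hx, Set.indicator_of_mem hx]
    exact mul_div_cancel₀ _ hA
  · simp [Set.indicator, hx]

lemma Distr.supportedOn_normalize {a : (Fin m → Bool) → ℝ} (ha : ∀ x, 0 ≤ a x)
    (hA : ∑ x, a x ≠ 0) {s : Set (Fin m → Bool)} (h : ∀ x, a x ≠ 0 → x ∈ s) :
    (normalize a ha hA).SupportedOn s :=
  fun x hx => h x fun h0 => hx (by simp [normalize, h0])

/-- If every pair of distributions has a tree with conflict at most `(k + 1) / 2`, then every `k`
queries decrease the error by a factor `1 - 1 / (8 k)`. -/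
lemma exists_errorOn_le_pow {k : ℕ} (hk : 0 < k)
    (H : ∀ μ₀ μ₁ : Distr m, μ₀.SupportedOn (validPreimage g false) →
      μ₁.SupportedOn (validPreimage g true) →
      ∃ T : DecisionTree m Bool, T.Computes g ∧ treeConflict T μ₀ μ₁ ≤ (k + 1) / 2) (n : ℕ) :
    ∀ a b : (Fin m → Bool) → ℝ, (∀ x, 0 ≤ a x) → (∀ x, 0 ≤ b x) →
      (∀ x, a x ≠ 0 → x ∈ validPreimage g false) → (∀ x, b x ≠ 0 → x ∈ validPreimage g true) →
      ∃ F : DecisionTree m Bool, (∀ x, F.numQueries x ≤ n * k) ∧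
        errorOn a b Set.univ F ≤ (1 - 1 / (8 * k)) ^ n * √((∑ x, a x) * ∑ x, b x) := by
  have hk1 : (1 : ℝ) ≤ k := by exact_mod_cast hk
  have hθ : (0 : ℝ) ≤ 1 - 1 / (8 * k) := by
    rw [sub_nonneg, div_le_one (by positivity)]
    linarith
  induction n with
  | zero =>
    intro a b ha hb _ _
    obtain ⟨s, hs⟩ := exists_errorOn_leaf_le ha hb
    exact ⟨.leaf s, fun x => by simp [DecisionTree.numQueries], by simpa using hs⟩
  | succ n ih =>
    intro a b ha hb hag hbg
    by_cases hAB : (∑ x, a x) * ∑ x, b x = 0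
    · obtain ⟨s, hs⟩ := exists_errorOn_leaf_le ha hb
      refine ⟨.leaf s, fun x => by simp [DecisionTree.numQueries], hs.trans_eq ?_⟩
      simp [hAB]
    obtain ⟨hA, hB⟩ := mul_ne_zero_iff.1 hAB
    have hA0 : 0 ≤ ∑ x, a x := Finset.sum_nonneg fun x _ => ha x
    have hB0 : 0 ≤ ∑ x, b x := Finset.sum_nonneg fun x _ => hb x
    have h₀ := Distr.supportedOn_normalize ha hA hag
    have h₁ := Distr.supportedOn_normalize hb hB hbg
    obtain ⟨T, hT, hTc⟩ := H _ _ h₀ h₁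
    have hκ : 0 ≤ (1 - 1 / (8 * k : ℝ)) ^ n * √((∑ x, a x) * ∑ x, b x) := by positivity
    have haff : affinity (Distr.normalize a ha hA) (Distr.normalize b hb hB) Set.univ = 1 := by
      simp [affinity, Distr.prob_univ]
    -- The gain `t/2 - t²k/2` is maximal at `t = 1/(2k)`, where it equals `1/(8k)`.
    obtain ⟨F, hFq, hFe⟩ := exists_errorOn_le h₀ h₁ (a := a) (b := b) hκ
      (t := 1 / (2 * k)) (by positivity) (L := n * k) (fun C => by
        obtain ⟨F, hFq, hFe⟩ := ih (C.indicator a) (C.indicator b)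
          (fun x => Set.indicator_nonneg (fun y _ => ha y) x)
          (fun x => Set.indicator_nonneg (fun y _ => hb y) x)
          (fun x hx => hag x (Set.indicator_apply_ne_zero.1 hx).2)
          (fun x hx => hbg x (Set.indicator_apply_ne_zero.1 hx).2)
        refine ⟨F, hFq, ?_⟩
        rw [errorOn_indicator] at hFe
        refine hFe.trans_eq ?_
        rw [← Distr.sum_mul_prob_normalize ha hA, ← Distr.sum_mul_prob_normalize hb hB,
          affinity, mul_mul_mul_comm, Real.sqrt_mul (mul_nonneg hA0 hB0)]
        ring)
      T Set.univ 1 k 1 one_pos zero_le_one haff.ge fun x _ => hT x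
    refine ⟨F, fun x => (hFq x).trans_eq (by ring), hFe.trans ?_⟩
    rw [haff, show (1 - 1 / (8 * k : ℝ)) ^ (n + 1) * √((∑ x, a x) * ∑ x, b x)
      = (1 - 1 / (8 * k : ℝ)) ^ n * √((∑ x, a x) * ∑ x, b x) * (1 - 1 / (8 * k : ℝ)) by ring]
    refine mul_le_mul_of_nonneg_left ?_ hκ
    have hc : conflictSum (Distr.normalize a ha hA) (Distr.normalize b hb hB) T Set.univ 1 1
        / ((1 : ℕ) + k) ≤ 1 / 2 := by
      rw [div_le_iff₀ (by positivity)]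
      refine hTc.trans_eq ?_
      push_cast
      ring
    have h2 := mul_le_mul_of_nonneg_left hc (show (0 : ℝ) ≤ 1 / (2 * k) by positivity)
    have e1 : (1 / (2 * k) : ℝ) ^ 2 * k * 1 / 2 = 1 / (8 * k) := by field_simp; norm_num
    have e2 : (1 / (2 * k) : ℝ) * (1 / 2) = 2 * (1 / (8 * k)) := by field_simp; norm_num
    have e3 : (1 / (2 * k) : ℝ) = 4 * (1 / (8 * k)) := by field_simp; norm_num
    rw [e1]
    rw [e2] at h2
    rw [mul_sub]
    linarith

end Rounds

/-- Yao's principle. -/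
lemma exists_randComputes {m : ℕ} {S : Type} {h : Set ((Fin m → Bool) × S)} {ε : ℝ} {l : ℕ}
    (H : ∀ μ : Distr m, ∃ T : DecisionTree m S, (∀ x, T.numQueries x ≤ l) ∧
      1 - ε ≤ μ.prob {x | (x, T.output x) ∈ h}) :
    ∃ A : PMF (DecisionTree m S), RandComputes A h ε ∧
      ∀ T ∈ A.support, ∀ x, T.numQueries x ≤ l := by
  let succ (T : DecisionTree m S) : (Fin m → Bool) → ℝ :=
    Set.indicator {x | (x, T.output x) ∈ h} 1
  let V : Set ((Fin m → Bool) → ℝ) := succ '' {T | ∀ x, T.numQueries x ≤ l}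
  have hV : V.Finite := by
    refine (Set.finite_range fun s : Set (Fin m → Bool) => s.indicator (1 : (Fin m → Bool) → ℝ)).subset ?_
    rintro _ ⟨T, -, rfl⟩
    exact ⟨_, rfl⟩
  -- A mixture of trees succeeds on all inputs iff the hull of the success vectors meets this
  -- orthant; otherwise a separating functional yields a hard distribution.
  by_cases hd : Disjoint (convexHull ℝ V) (Set.Ici fun _ => 1 - ε)
  · exfalso
    obtain ⟨f, u, v, hfu, huv, hfv⟩ := geometric_hahn_banach_compact_closed (convex_convexHull ℝ V)
      (hV.isCompact_convexHull ℝ) (convex_Ici _) isClosed_Ici hd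
    let w : (Fin m → Bool) → ℝ := fun x => f (Pi.single x 1)
    have hf : ∀ y, f y = ∑ x, y x * w x := fun y => by
      conv_lhs => rw [pi_eq_sum_univ' y]
      simp [w]
    have hw : ∀ x, 0 ≤ w x := by
      intro x
      by_contra! hx
      have h0 : v < f fun _ => 1 - ε := hfv _ Set.self_mem_Ici
      -- Moving by `c` in direction `x` stays in the orthant but brings `f` down to exactly `v`.
      let c : ℝ := (f (fun _ => 1 - ε) - v) / -w x
      have hc : 0 ≤ c := div_nonneg (sub_nonneg.2 h0.le) (neg_nonneg.2 hx.le)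
      have := hfv ((fun _ => 1 - ε) + c • Pi.single x 1) (by
        exact Set.mem_Ici.2 (le_add_of_nonneg_right
          (smul_nonneg hc (Pi.single_nonneg.2 zero_le_one))))
      rw [map_add, map_smul, smul_eq_mul] at this
      have e : c * w x = -(f (fun _ => 1 - ε) - v) := by
        rw [div_mul_eq_mul_div, div_neg, mul_div_cancel_right₀ _ hx.ne]
      change v < f (fun _ => 1 - ε) + c * w x at this
      linarith
    have hK : v < f fun _ => 1 - ε := hfv _ Set.self_mem_Ici
    have hVu : ∀ T : DecisionTree m S, (∀ x, T.numQueries x ≤ l) → f (succ T) < u := fun T hT =>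
      hfu _ (subset_convexHull ℝ V ⟨T, hT, rfl⟩)
    have hW : ∑ x, w x ≠ 0 := by
      intro hW
      have hw0 : ∀ x, w x = 0 := fun x =>
        (Finset.sum_eq_zero_iff_of_nonneg fun x _ => hw x).1 hW x (Finset.mem_univ x)
      have hf0 : ∀ y, f y = 0 := fun y => by simp [hf, hw0]
      -- Any distribution serves here: only the existence of a tree is needed, giving `0 < u < v <
      -- 0` when `f = 0`.
      obtain ⟨T, hT, -⟩ := H (⟨Pi.single default 1, single_mem_stdSimplex ℝ _⟩ : Distr m)
      have := hVu T hT
      rw [hf0] at this hK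
      linarith
    obtain ⟨T, hT, hTp⟩ := H (Distr.normalize w hw hW)
    have hW0 : 0 ≤ ∑ x, w x := Finset.sum_nonneg fun x _ => hw x
    have h1 := mul_le_mul_of_nonneg_left hTp hW0
    rw [Distr.sum_mul_prob_normalize] at h1
    have h2 := hVu T hT
    have e2 : f (succ T) = ∑ x, Set.indicator {x | (x, T.output x) ∈ h} w x := by
      rw [hf]
      refine Finset.sum_congr rfl fun x _ => ?_
      by_cases hx : (x, T.output x) ∈ h <;> simp [succ, Set.indicator, hx]
    have e3 : f (fun _ => 1 - ε) = (∑ x, w x) * (1 - ε) := by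
      rw [hf, ← Finset.mul_sum, mul_comm]
    rw [e2] at h2
    rw [e3] at hK
    linarith
  · obtain ⟨y, hyV, hy⟩ := Set.not_disjoint_iff.1 hd
    obtain ⟨ι, _, w, z, hw, hw1, hz, hwz⟩ := mem_convexHull_iff_exists_fintype.1 hyV
    choose T hT hTz using hz
    let P : PMF ι := PMF.ofFintype (fun i => ENNReal.ofReal (w i)) (by
      rw [← ENNReal.ofReal_sum_of_nonneg fun i _ => hw i, hw1, ENNReal.ofReal_one])
    refine ⟨P.map T, fun x => ?_, fun U hU => ?_⟩
    · rw [PMF.toOuterMeasure_map_apply, PMF.toOuterMeasure_ofFintype_apply]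
      have e : ∀ i, (T ⁻¹' {U | (x, U.output x) ∈ h}).indicator (fun i => ENNReal.ofReal (w i)) i
          = ENNReal.ofReal (w i * z i x) := fun i => by
        rw [← hTz i]
        by_cases hi : (x, (T i).output x) ∈ h <;> simp [succ, Set.indicator, hi]
      simp_rw [e]
      rw [tsum_fintype]
      rw [← ENNReal.ofReal_sum_of_nonneg]
      · refine ENNReal.ofReal_le_ofReal ?_
        have := hy x
        rw [← hwz] at this
        simpa [Finset.sum_apply] using this
      · intro i _
        refine mul_nonneg (hw i) ?_
        rw [← hTz i]
        exact Set.indicator_nonneg (fun _ _ => zero_le_one) x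
    · obtain ⟨i, -, rfl⟩ := (PMF.mem_support_map_iff _ _ _).1 hU
      exact hT i

/-! ### From distributional error to the lower bounds -/

section Main

variable {m : ℕ} {g : Set ((Fin m → Bool) × Bool)}

lemma randQueryComplexity_le_of_forall {ε : ℝ} {l : ℕ} (hg : IsPartialBoolFun g)
    (H : ∀ a b : (Fin m → Bool) → ℝ, (∀ x, 0 ≤ a x) → (∀ x, 0 ≤ b x) →
      (∀ x, a x ≠ 0 → x ∈ validPreimage g false) → (∀ x, b x ≠ 0 → x ∈ validPreimage g true) →
      ∑ x, a x ≤ 1 → ∑ x, b x ≤ 1 →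
      ∃ F : DecisionTree m Bool, (∀ x, F.numQueries x ≤ l) ∧ errorOn a b Set.univ F ≤ ε) :
    randQueryComplexity ε g ≤ l := by
  refine Nat.sInf_le (exists_randComputes fun μ => ?_)
  have hle : ∀ s : Set (Fin m → Bool), ∑ x, s.indicator μ.1 x ≤ 1 := fun s =>
    (Finset.sum_le_sum fun x _ => Set.indicator_le_self' (fun _ _ => μ.2.1 x) x).trans_eq μ.2.2
  obtain ⟨F, hFq, hFe⟩ := H ((validPreimage g false).indicator μ.1)
    ((validPreimage g true).indicator μ.1)
    (fun x => Set.indicator_nonneg (fun y _ => μ.2.1 y) x)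
    (fun x => Set.indicator_nonneg (fun y _ => μ.2.1 y) x)
    (fun x hx => (Set.indicator_apply_ne_zero.1 hx).1)
    (fun x hx => (Set.indicator_apply_ne_zero.1 hx).1) (hle _) (hle _)
  refine ⟨F, hFq, ?_⟩
  -- Errors occur only on valid inputs, where the wrong output identifies which of the two weights
  -- is charged.
  have key : 1 ≤ μ.prob {x | (x, F.output x) ∈ g} +
      errorOn ((validPreimage g false).indicator μ.1)
        ((validPreimage g true).indicator μ.1) Set.univ F := by
    rw [Distr.prob, errorOn, ← Finset.sum_add_distrib]
    refine μ.2.2.symm.trans_le (Finset.sum_le_sum fun x _ => ?_)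
    have hμ : 0 ≤ μ.1 x := μ.2.1 x
    rw [Set.indicator_univ]
    by_cases hx : (x, F.output x) ∈ g
    · rw [Set.indicator_of_mem (show x ∈ {x | (x, F.output x) ∈ g} from hx)]
      refine le_add_of_nonneg_right ?_
      split_ifs <;> exact Set.indicator_nonneg (fun y _ => μ.2.1 y) x
    · rw [Set.indicator_of_notMem (show x ∉ {x | (x, F.output x) ∈ g} from hx), zero_add]
      have hv : x ∈ validPreimage g false ∪ validPreimage g true := by
        by_contra hv
        have := hg x hv
        cases ho : F.output x <;> simp_all
      cases ho : F.output x
      · have hx1 : x ∈ validPreimage g true :=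
          hv.resolve_left fun h => hx (ho ▸ h.1)
        simp [hx1]
      · have hx0 : x ∈ validPreimage g false :=
          hv.resolve_right fun h => hx (ho ▸ h.1)
        simp [hx0]
  linarith

lemma randQueryComplexity_eq_zero {ε : ℝ} (hε : 0 ≤ ε) (hg : IsPartialBoolFun g)
    (h : validPreimage g false = ∅ ∨ validPreimage g true = ∅) : randQueryComplexity ε g = 0 := by
  refine Nat.le_zero.1 (randQueryComplexity_le_of_forall hg fun a b _ _ ha hb _ _ => ?_)
  rcases h with h | h
  · refine ⟨.leaf true, fun x => le_rfl, le_of_eq_of_le (Finset.sum_eq_zero fun x _ => ?_) hε⟩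
    by_contra hx
    exact Set.notMem_empty x (h ▸ ha x (by simpa [DecisionTree.output] using hx))
  · refine ⟨.leaf false, fun x => le_rfl, le_of_eq_of_le (Finset.sum_eq_zero fun x _ => ?_) hε⟩
    by_contra hx
    exact Set.notMem_empty x (h ▸ hb x (by simpa [DecisionTree.output] using hx))

lemma one_le_treeConflict {μ₀ μ₁ : Distr m} (h₀ : μ₀.SupportedOn (validPreimage g false))
    (h₁ : μ₁.SupportedOn (validPreimage g true)) {T : DecisionTree m Bool} (hT : T.Computes g) :
    1 ≤ treeConflict T μ₀ μ₁ := by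
  simpa [treeConflict] using mul_le_conflictSum h₀ h₁ T Set.univ 1 1 zero_le_one
    (by simp [affinity, Distr.prob_univ]) fun x _ => hT x

/-- The point mass at `x`. -/
noncomputable def Distr.dirac (x : Fin m → Bool) : Distr m :=
  ⟨Pi.single x 1, single_mem_stdSimplex ℝ x⟩

lemma Distr.supportedOn_dirac {x : Fin m → Bool} {s : Set (Fin m → Bool)} (hx : x ∈ s) :
    (dirac x).SupportedOn s := by
  intro y hy
  rcases eq_or_ne y x with rfl | h
  · exact hx
  · exact absurd (Pi.single_eq_of_ne h _) hy

lemma randQueryComplexity_le_of_treeConflict_le {k : ℕ} (hg : IsPartialBoolFun g) (hk : 0 < k)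
    (H : ∀ μ₀ μ₁ : Distr m, μ₀.SupportedOn (validPreimage g false) →
      μ₁.SupportedOn (validPreimage g true) →
      ∃ T : DecisionTree m Bool, T.Computes g ∧ treeConflict T μ₀ μ₁ ≤ (k + 1) / 2) :
    randQueryComplexity (1 / 3) g ≤ 16 * k * k := by
  refine randQueryComplexity_le_of_forall hg fun a b ha hb hag hbg hA hB => ?_
  obtain ⟨F, hFq, hFe⟩ := exists_errorOn_le_pow hk H (16 * k) a b ha hb hag hbg
  refine ⟨F, hFq, hFe.trans ?_⟩
  have hk1 : (1 : ℝ) ≤ k := by exact_mod_cast hk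
  have hθ : (0 : ℝ) ≤ 1 - 1 / (8 * k) := by
    rw [sub_nonneg, div_le_one (by positivity)]
    linarith
  have hs : √((∑ x, a x) * ∑ x, b x) ≤ 1 :=
    Real.sqrt_le_one.2 (mul_le_one₀ hA (Finset.sum_nonneg fun x _ => hb x) hB)
  have hexp : (1 - 1 / (8 * k : ℝ)) ^ (16 * k) ≤ Real.exp (-2) := by
    have h1 : 1 - 1 / (8 * k : ℝ) ≤ Real.exp (-(1 / (8 * k))) := Real.one_sub_le_exp_neg _
    refine (pow_le_pow_left₀ hθ h1 _).trans_eq ?_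
    rw [← Real.exp_nat_mul]
    congr 1
    push_cast
    field_simp
    norm_num
  have h3 : Real.exp (-2) ≤ 1 / 3 := by
    rw [Real.exp_neg, one_div]
    refine inv_anti₀ (by norm_num) ?_
    linarith [Real.add_one_le_exp (2 : ℝ)]
  exact (mul_le_of_le_one_right (by positivity) hs).trans (hexp.trans h3)

lemma ofReal_sqrt_le_conflictComplexity (hg : IsPartialBoolFun g) :
    ENNReal.ofReal (1 / 13 * √(randQueryComplexity (1 / 3) g : ℝ)) ≤ conflictComplexity g := by
  by_cases hne : validPreimage g false = ∅ ∨ validPreimage g true = ∅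
  · rw [randQueryComplexity_eq_zero (by norm_num) hg hne]
    simp
  rw [not_or, ← ne_eq, ← ne_eq, ← Set.nonempty_iff_ne_empty, ← Set.nonempty_iff_ne_empty] at hne
  obtain ⟨⟨x₀, hx₀⟩, x₁, hx₁⟩ := hne
  by_contra! hlt
  set D : ℝ := 1 / 13 * √(randQueryComplexity (1 / 3) g : ℝ) with hD
  have H : ∀ μ₀ μ₁ : Distr m, μ₀.SupportedOn (validPreimage g false) →
      μ₁.SupportedOn (validPreimage g true) →
      ∃ T : DecisionTree m Bool, T.Computes g ∧ treeConflict T μ₀ μ₁ < D := by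
    intro μ₀ μ₁ h₀ h₁
    have hlt' : (⨅ (T : DecisionTree m Bool) (_ : T.Computes g),
        ENNReal.ofReal (treeConflict T μ₀ μ₁)) < ENNReal.ofReal D := by
      refine lt_of_le_of_lt ?_ hlt
      exact le_iSup₂_of_le μ₀ μ₁ (le_iSup₂_of_le h₀ h₁ le_rfl)
    obtain ⟨T, hT⟩ := iInf_lt_iff.1 hlt'
    obtain ⟨hTg, hT⟩ := iInf_lt_iff.1 hT
    exact ⟨T, hTg, (ENNReal.ofReal_lt_ofReal_iff_of_nonneg
      (zero_le_one.trans (one_le_treeConflict h₀ h₁ hTg))).1 hT⟩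
  have hD1 : 1 < D := by
    obtain ⟨T, hTg, hT⟩ := H _ _ (Distr.supportedOn_dirac hx₀) (Distr.supportedOn_dirac hx₁)
    exact (one_le_treeConflict (Distr.supportedOn_dirac hx₀)
      (Distr.supportedOn_dirac hx₁) hTg).trans_lt hT
  -- With `k = ⌈2D⌉`, conflict below `D` is below `(k+1)/2`; and `D > 1` gives `k ≤ 3D`.
  have hk : 0 < ⌈2 * D⌉₊ := Nat.ceil_pos.2 (by linarith)
  have hR := randQueryComplexity_le_of_treeConflict_le hg hk fun μ₀ μ₁ h₀ h₁ => by
    obtain ⟨T, hTg, hT⟩ := H μ₀ μ₁ h₀ h₁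
    refine ⟨T, hTg, ?_⟩
    linarith [Nat.le_ceil (2 * D)]
  have hk3 : (⌈2 * D⌉₊ : ℝ) ≤ 3 * D := by
    linarith [Nat.ceil_lt_add_one (show 0 ≤ 2 * D by linarith)]
  have hR' : (randQueryComplexity (1 / 3) g : ℝ) ≤ 16 * ⌈2 * D⌉₊ * ⌈2 * D⌉₊ := by
    exact_mod_cast hR
  have hsq : (randQueryComplexity (1 / 3) g : ℝ) = (13 * D) ^ 2 := by
    rw [hD, ← mul_assoc, mul_one_div_cancel (by norm_num), one_mul,
      Real.sq_sqrt (Nat.cast_nonneg _)]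
  rw [hsq] at hR'
  -- The contradiction is `(13D)² ≤ 16 · (3D)² = (12D)²` with `D > 1`.
  nlinarith [mul_le_mul hk3 hk3 (Nat.cast_nonneg _) (by linarith)]

lemma conflictComplexity_le_maxConflictComplexity :
    conflictComplexity g ≤ maxConflictComplexity g := by
  refine iSup₂_le fun μ₀ μ₁ => iSup₂_le fun h₀ h₁ => ?_
  let Q : ProbabilityMeasure (Distr m × Distr m) := ⟨Measure.dirac (μ₀, μ₁), inferInstance⟩
  have hQ : ConsistentWith Q g := by
    change ∀ᵐ p ∂(Measure.dirac (μ₀, μ₁)), _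
    rw [ae_dirac_eq]
    exact ⟨h₀, h₁⟩
  refine le_iSup₂_of_le Q hQ (iInf₂_mono fun T _ => ?_)
  exact (lintegral_dirac _ _).ge

end Main

theorem theorem1 :
    ∃ c : ℝ, 0 < c ∧ ∀ (m : ℕ) (g : Set ((Fin m → Bool) × Bool)), IsPartialBoolFun g →
      ENNReal.ofReal (c * √(randQueryComplexity (1 / 3) g : ℝ)) ≤ conflictComplexity g ∧
      ENNReal.ofReal (c * √(randQueryComplexity (1 / 3) g : ℝ)) ≤ maxConflictComplexity g :=
  ⟨1 / 13, by norm_num, fun _ _ hg => ⟨ofReal_sqrt_le_conflictComplexity hg,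
    (ofReal_sqrt_le_conflictComplexity hg).trans conflictComplexity_le_maxConflictComplexity⟩⟩
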